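/- **Theorem 4.** Let $\mathcal W\subset\mathbb R^d$ be a non-empty closed convex set with Euclidean projection $\Pi_{\mathcal W}$, let $\mathsf F$ be a family of real-valued cost functions on $\mathcal W$, and let $n\ge 1$. For each iteration $t\in[n]=\{1,\dots,n\}$ let $\sigma_t>0$ and let $\Psi^{(t)}_{\mathsf f}:\mathcal W\to\mathbb R^d$ ($\mathsf f\in\mathsf F$) be measurable update rules (in particular, they may be the same rules $\Psi^{(t)}_{\mathsf f}=\Psi_{\mathsf f}$ for all $t$). For a collection $\{\mathsf f_t\}=(\mathsf f_1,\dots,\mathsf f_n)\in\mathsf F^n$ consider the iterative process $$W_{t+1}=\Pi_{\mathcal W}\big(\Psi^{(t)}_{\mathsf f_t}(W_t)+\sigma_tZ_t\big),\qquad t=1,\dots,n,$$ where $W_1$ is a random point of $\mathcal W$ with arbitrary distribution and $Z_1,\dots,Z_n$ are i.i.d. $\mathcal N(0,\mathbf I_d)$, independent of $W_1$; its output is $\mathcal M(\{\mathsf f_t\})=W_{n+1}$. Two collections are neighboring at index $i\in[n]$, written $\{\mathsf f_t\}\overset{i}{\sim}\{\mathsf f'_t\}$, if $\mathsf f_t=\mathsf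 f'_t$ for all $t\neq i$ and $\mathsf f_i\neq\mathsf f'_i$. With $\mathsf Q(a)=\frac1{\sqrt{2\pi}}\int_a^\infty e^{-u^2/2}\,du$ and $\gamma\ge1$ put $$\theta_\gamma(r)=\mathsf Q\Big(\frac{\log\gamma}{r}-\frac r2\Big)-\gamma\,\mathsf Q\Big(\frac{\log\gamma}{r}+\frac r2\Big)\quad(0<r<\infty),\qquad \theta_\gamma(0)=0,\quad\theta_\gamma(\infty)=1 .$$ Let $i\in[n]$ and $\varepsilon\ge0$. Let $\operatorname{dia}$ denote the diameter of a set, put $$\psi=\sup_{\mathsf f,\mathsf g\in\mathsf F}\ \sup_{w\in\mathcal W}\big\|\Psi^{(i)}_{\mathsf f}(w)-\Psi^{(i)}_{\mathsf g}(w)\big\|\in[0,\infty],$$ and for $\{\mathsf f_t\}\in\mathsf F^n$ put $$\delta(\{\mathsf f_t\})=\theta_{e^\varepsilon}\Big(\frac{\psi}{\sigma_i}\Big)\prod_{t=i+1}^n\theta_{e^\varepsilon}\Big(\frac{\operatorname{dia}(\Psi^{(t)}_{\mathsf f_t}(\mathcal W))}{\sigma_t}\Big).$$ Then the process is differentially private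 at index $i$ with parameters $\varepsilon$ and $\delta$: for all $\{\mathsf f_t\}\overset{i}{\sim}\{\mathsf f'_t\}$ in $\mathsf F^n$ and all measurable $A\subset\mathcal W$, $$\Pr\big(\mathcal M(\{\mathsf f_t\})\in A\big)-e^{\varepsilon}\Pr\big(\mathcal M(\{\mathsf f'_t\})\in A\big)\le\delta(\{\mathsf f_t\}).$$ In particular, it is $(\varepsilon,\delta)$-differentially private at index $i$ with the constant $\delta=\sup_{\{\mathsf f_t\}\in\mathsf F^n}\delta(\{\mathsf f_t\})$, that is, the left side is at most this constant for all such $\{\mathsf f_t\}$, $\{\mathsf f'_t\}$ and $A$. -/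

import Mathlib

open MeasureTheory ProbabilityTheory
open scoped ENNReal

noncomputable section

/-- The Gaussian tail function `Q(a) = (2π)^{-1/2} ∫_a^∞ e^{-u²/2} du`. -/
def gaussianQ (a : ℝ) : ℝ :=
  (Real.sqrt (2 * Real.pi))⁻¹ * ∫ u in Set.Ioi a, Real.exp (-u ^ 2 / 2)

/-- `θ_γ(r) = Q(log γ / r - r / 2) - γ Q(log γ / r + r / 2)` for `0 < r < ∞`, which is the
`E_γ`-divergence of two standard Gaussians whose means have distance `r`. At the end points it
takes its limit values (for `γ ≥ 1`): `θ_γ(0) = 0` and `θ_γ(∞) = 1`. -/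
def theta (γ : ℝ) (r : ℝ≥0∞) : ℝ :=
  if r = 0 then 0
  else if r = ⊤ then 1
  else gaussianQ (Real.log γ / r.toReal - r.toReal / 2)
    - γ * gaussianQ (Real.log γ / r.toReal + r.toReal / 2)

section OnlineAlg

variable {d : ℕ} {W : Set (EuclideanSpace ℝ (Fin d))}

/-- The projection `Π_W` onto a non-empty closed set `W`: a point of `W` nearest to `x`
(the only one if `W` is convex). -/
def projOnto (hne : W.Nonempty) (hcl : IsClosed W) (x : EuclideanSpace ℝ (Fin d)) : W :=
  ⟨(hcl.exists_infDist_eq_dist hne x).choose,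
    (hcl.exists_infDist_eq_dist hne x).choose_spec.1⟩

/-- `n` iterations of `w ↦ Π_W (Φ_t w + σ_t z_t)`, `t = 0, …, n - 1`, starting from `w`. -/
def noisyIterate (hne : W.Nonempty) (hcl : IsClosed W) :
    (n : ℕ) → (Fin n → W → EuclideanSpace ℝ (Fin d)) → (Fin n → ℝ) → W →
      (Fin n → EuclideanSpace ℝ (Fin d)) → W
  | 0, _, _, w, _ => w
  | n + 1, Φ, σ, w, z =>
      projOnto hne hcl
        (Φ (Fin.last n)
            (noisyIterate hne hcl n (fun t => Φ t.castSucc) (fun t => σ t.castSucc) w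
              (fun t => z t.castSucc))
          + σ (Fin.last n) • z (Fin.last n))

/-- The online algorithm `(f_1, …, f_n) ↦ W_{n+1}` given by
`W_{t+1} = Π_W (Ψ_{f_t}(W_t) + σ_t Z_t)`; time `t ∈ {1, …, n}` is the index `t - 1 : Fin n`.
The update rule is `Ψ t f : W → ℝ^d` for the cost function `f` at iteration `t`. -/
def onlineAlgorithm {Ω : Type*} {n : ℕ} (hne : W.Nonempty) (hcl : IsClosed W)
    {F : Set (W → ℝ)} (Ψ : Fin n → F → W → EuclideanSpace ℝ (Fin d)) (σ : Fin n → ℝ)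
    (W₁ : Ω → W) (Z : Fin n → Ω → EuclideanSpace ℝ (Fin d)) (f : Fin n → F) (ω : Ω) : W :=
  noisyIterate hne hcl n (fun t => Ψ t (f t)) σ (W₁ ω) (fun t => Z t ω)

/-- `ψ = sup_{f₁, f₂ ∈ F} sup_{w ∈ W} ‖Ψ_{f₁}(w) - Ψ_{f₂}(w)‖`, in `[0, ∞]`. -/
def updateGap {F : Set (W → ℝ)} (Ψ : F → W → EuclideanSpace ℝ (Fin d)) : ℝ≥0∞ :=
  ⨆ (f₁ : F) (f₂ : F) (w : W), ‖Ψ f₁ w - Ψ f₂ w‖ₑ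

/-- `θ_{e^ε}(ψ / σ_i) ∏_{t > i} θ_{e^ε}(dia (Ψ_{f_t}(W)) / σ_t)`. -/
def privacyDelta {n : ℕ} {F : Set (W → ℝ)} (Ψ : Fin n → F → W → EuclideanSpace ℝ (Fin d))
    (σ : Fin n → ℝ) (ε : ℝ) (i : Fin n) (f : Fin n → F) : ℝ :=
  theta (Real.exp ε) (updateGap (Ψ i) / ENNReal.ofReal (σ i)) *
    ∏ t ∈ Finset.Ioi i,
      theta (Real.exp ε) (Metric.ediam (Set.range (Ψ t (f t))) / ENNReal.ofReal (σ t))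

end OnlineAlg

/-- Two collections `f`, `f'` are neighboring at index `i`: they differ at `i` and only there. -/
def Neighboring {n : ℕ} {𝓕 : Type*} (i : Fin n) (f f' : Fin n → 𝓕) : Prop :=
  (∀ t, t ≠ i → f t = f' t) ∧ f i ≠ f' i

/-- The randomized algorithm `M` is `(ε, δ)`-differentially private at index `i`. -/
def IsDPAtIndex {Ω S 𝓕 : Type*} [MeasurableSpace Ω] [MeasurableSpace S] {n : ℕ}
    (P : Measure Ω) (M : (Fin n → 𝓕) → Ω → S) (i : Fin n) (ε δ : ℝ) : Prop :=
  ∀ f f' : Fin n → 𝓕, Neighboring i f f' → ∀ A : Set S, MeasurableSet A →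
    P.real (M f ⁻¹' A) - Real.exp ε * P.real (M f' ⁻¹' A) ≤ δ

end

/-! Put γ = e^ε and compare the two output laws in the hockey-stick divergence E_γ(μ, ν) = sup_A
(μ(A) − γ ν(A)). Before step i the two processes have the same law. At step i, conditionally on the
common state, they draw Gaussians whose means are at most ψ apart, so E_γ is at most θ_γ(ψ/σ_i);
this is Neyman–Pearson on the line (`gaussianReal_real_sub_le`), carried to ℝ^d by slicing
(`stdGaussian_real_shift_sub_le`). Every later step applies one Markov kernel to both laws. Such a
kernel multiplies E_γ by at most the largest divergence between two of its rows
(`HockeyStickLE.integral_sub_le_mul`), and the rows are Gaussians with means at most dia(Ψ(W))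
apart. The projection is post-processing: it only replaces A by a preimage. Induction on the number
of steps (`hockeyStickLE_noisyIterateLaw`) gives the product. -/

/-! ### Shifted Gaussians on the line and properties of θ_γ. -/

section GaussianLine

theorem gaussianReal_real_eq_setIntegral (m : ℝ) (C : Set ℝ) :
    (gaussianReal m 1).real C = ∫ x in C, gaussianPDFReal m 1 x := by
  rw [measureReal_def, gaussianReal_apply_eq_integral m one_ne_zero C, ENNReal.toReal_ofReal]
  exact integral_nonneg fun x => gaussianPDFReal_nonneg m 1 x

theorem gaussianReal_real_Ioi (m c : ℝ) :
    (gaussianReal m 1).real (Set.Ioi c) = gaussianQ (c - m) := by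
  have h : gaussianReal m 1 = (gaussianReal 0 1).map (fun x => x + m) := by
    rw [gaussianReal_map_add_const, zero_add]
  rw [h, map_measureReal_apply (by fun_prop) measurableSet_Ioi]
  have h2 : (fun x => x + m) ⁻¹' Set.Ioi c = Set.Ioi (c - m) := by
    ext x; simp [sub_lt_iff_lt_add]
  rw [h2, gaussianReal_real_eq_setIntegral, gaussianQ, ← integral_const_mul]
  refine integral_congr_ae (ae_of_all _ fun x => ?_)
  simp [gaussianPDFReal_def]

theorem gaussianQ_nonneg (a : ℝ) : 0 ≤ gaussianQ a := by
  have := gaussianReal_real_Ioi 0 a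
  rw [sub_zero] at this
  exact this ▸ measureReal_nonneg

theorem gaussianQ_le_one (a : ℝ) : gaussianQ a ≤ 1 := by
  have := gaussianReal_real_Ioi 0 a
  rw [sub_zero] at this
  exact this ▸ measureReal_le_one

theorem gaussianQ_antitone : Antitone gaussianQ := by
  intro a b hab
  have ha := gaussianReal_real_Ioi 0 a
  have hb := gaussianReal_real_Ioi 0 b
  rw [sub_zero] at ha hb
  rw [← ha, ← hb]
  exact measureReal_mono (Set.Ioi_subset_Ioi hab)

theorem gaussianPDFReal_eq_exp_mul (r x : ℝ) :
    gaussianPDFReal r 1 x = Real.exp (r * x - r ^ 2 / 2) * gaussianPDFReal 0 1 x := by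
  simp only [gaussianPDFReal_def, NNReal.coe_one]
  rw [mul_left_comm, ← Real.exp_add]
  congr 2
  ring

/-- Neyman–Pearson bound: half lines maximize the difference between a shifted standard Gaussian
and `γ` times the standard Gaussian. -/
theorem gaussianReal_real_sub_le {γ r : ℝ} (hγ : 0 < γ) (hr : 0 < r) {C : Set ℝ}
    (hC : MeasurableSet C) :
    (gaussianReal r 1).real C - γ * (gaussianReal 0 1).real C ≤
      gaussianQ (Real.log γ / r - r / 2) - γ * gaussianQ (Real.log γ / r + r / 2) := by
  -- The likelihood ratio exp(r x − r²/2) of N(r,1) to N(0,1) increases in x and equals γ at c, so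
  -- `h` changes sign only there.
  set c := Real.log γ / r + r / 2 with hc
  have hc' : Real.log γ / r - r / 2 = c - r := by rw [hc]; ring
  have hlog : r * c - r ^ 2 / 2 = Real.log γ := by rw [hc]; field_simp; ring
  set h : ℝ → ℝ := fun x => gaussianPDFReal r 1 x - γ * gaussianPDFReal 0 1 x with hh
  have hint : Integrable h volume :=
    (integrable_gaussianPDFReal r 1).sub ((integrable_gaussianPDFReal 0 1).const_mul γ)
  have hval (D : Set ℝ) :
      (gaussianReal r 1).real D - γ * (gaussianReal 0 1).real D = ∫ x in D, h x := by
    rw [gaussianReal_real_eq_setIntegral, gaussianReal_real_eq_setIntegral, hh,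
      integral_sub (integrable_gaussianPDFReal r 1).integrableOn
        ((integrable_gaussianPDFReal 0 1).const_mul γ).integrableOn, integral_const_mul]
  have hfac (x : ℝ) : h x = (Real.exp (r * x - r ^ 2 / 2) - γ) * gaussianPDFReal 0 1 x := by
    simp only [hh]
    rw [gaussianPDFReal_eq_exp_mul]
    ring
  have hpos (x : ℝ) (hx : c < x) : 0 ≤ h x := by
    rw [hfac]
    refine mul_nonneg (sub_nonneg.2 ?_) (gaussianPDFReal_nonneg 0 1 x)
    rw [← Real.log_le_iff_le_exp hγ, ← hlog]
    gcongr
  have hneg (x : ℝ) (hx : x ≤ c) : h x ≤ 0 := by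
    rw [hfac]
    refine mul_nonpos_of_nonpos_of_nonneg (sub_nonpos.2 ?_) (gaussianPDFReal_nonneg 0 1 x)
    rw [← Real.le_log_iff_exp_le hγ, ← hlog]
    gcongr
  have hQ := hval (Set.Ioi c)
  rw [gaussianReal_real_Ioi, gaussianReal_real_Ioi, sub_zero] at hQ
  rw [hc', hQ, hval, ← integral_indicator hC, ← integral_indicator measurableSet_Ioi]
  refine integral_mono (hint.indicator hC) (hint.indicator measurableSet_Ioi) fun x => ?_
  by_cases hx : c < x
  · rw [Set.indicator_of_mem (Set.mem_Ioi.2 hx)]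
    exact Set.indicator_le_self' (fun _ _ => hpos x hx) x
  · rw [Set.indicator_of_notMem (s := Set.Ioi c) (by simpa using hx)]
    exact Set.indicator_apply_le' (fun _ => hneg x (not_lt.1 hx)) fun _ => le_rfl

theorem theta_ofReal {γ r : ℝ} (hr : 0 < r) :
    theta γ (ENNReal.ofReal r) =
      gaussianQ (Real.log γ / r - r / 2) - γ * gaussianQ (Real.log γ / r + r / 2) := by
  rw [theta, if_neg (by simpa using hr), if_neg ENNReal.ofReal_ne_top,
    ENNReal.toReal_ofReal hr.le]

theorem ennreal_cases_zero_top_ofReal {p : ℝ≥0∞ → Prop} (h0 : p 0) (htop : p ⊤)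
    (h : ∀ r : ℝ, 0 < r → p (ENNReal.ofReal r)) (r : ℝ≥0∞) : p r := by
  by_cases hr0 : r = 0
  · exact hr0 ▸ h0
  by_cases hrt : r = ⊤
  · exact hrt ▸ htop
  rw [← ENNReal.ofReal_toReal hrt]
  exact h _ (ENNReal.toReal_pos hr0 hrt)

theorem theta_nonneg {γ : ℝ} (hγ : 0 < γ) (r : ℝ≥0∞) : 0 ≤ theta γ r := by
  induction r using ennreal_cases_zero_top_ofReal with
  | h0 => simp [theta]
  | htop => simp [theta]
  | h r hr =>
    rw [theta_ofReal hr]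
    simpa using gaussianReal_real_sub_le hγ hr MeasurableSet.empty

theorem theta_le_one {γ : ℝ} (hγ : 0 < γ) (r : ℝ≥0∞) : theta γ r ≤ 1 := by
  induction r using ennreal_cases_zero_top_ofReal with
  | h0 => simp [theta]
  | htop => simp [theta]
  | h r hr =>
    rw [theta_ofReal hr]
    have := mul_nonneg hγ.le (gaussianQ_nonneg (Real.log γ / r + r / 2))
    have := gaussianQ_le_one (Real.log γ / r - r / 2)
    linarith

/-- The half line that is optimal for shift s is a competitor for a shift r ≥ s: its N(0,1)-mass is
the same and its N(r,1)-mass is at least its N(s,1)-mass. -/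
theorem theta_mono {γ : ℝ} (hγ : 0 < γ) : Monotone (theta γ) := by
  intro s r
  induction s using ennreal_cases_zero_top_ofReal with
  | h0 => exact fun _ => by simpa [theta] using theta_nonneg hγ r
  | htop => exact fun h => by rw [top_le_iff.1 h]
  | h s hs =>
    induction r using ennreal_cases_zero_top_ofReal with
    | h0 => exact fun h => absurd hs (by simpa using h)
    | htop => exact fun _ => by simpa [theta] using theta_le_one hγ (ENNReal.ofReal s)
    | h r hr =>
      intro h
      have hsr : s ≤ r := (ENNReal.ofReal_le_ofReal_iff hr.le).1 h
      rw [theta_ofReal hs, theta_ofReal hr]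
      have h1 := gaussianReal_real_sub_le hγ hr (C := Set.Ioi (Real.log γ / s + s / 2))
        measurableSet_Ioi
      rw [gaussianReal_real_Ioi, gaussianReal_real_Ioi, sub_zero] at h1
      have h2 : gaussianQ (Real.log γ / s - s / 2) ≤ gaussianQ (Real.log γ / s + s / 2 - r) :=
        gaussianQ_antitone (by linarith)
      linarith

end GaussianLine

theorem measureReal_prod_eq_integral {α β : Type*} [MeasurableSpace α] [MeasurableSpace β]
    (μ : Measure α) (ν : Measure β) [IsFiniteMeasure μ] [IsFiniteMeasure ν] {A : Set (α × β)}
    (hA : MeasurableSet A) : (μ.prod ν).real A = ∫ x, ν.real (Prod.mk x ⁻¹' A) ∂μ := by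
  rw [← integral_indicator_one hA,
    integral_prod (A.indicator 1) ((integrable_const (1 : ℝ)).indicator hA)]
  refine integral_congr_ae (ae_of_all _ fun x => ?_)
  simp only
  rw [← integral_indicator_one (measurable_prodMk_left hA)]
  rfl

/-! ### Shifted Gaussians in Euclidean space, by slicing. -/

section GaussianSpace

variable {E : Type*} [NormedAddCommGroup E] [InnerProductSpace ℝ E] [FiniteDimensional ℝ E]
  [MeasurableSpace E] [BorelSpace E]

open scoped RealInnerProductSpace

/-- Resampling the coordinate of a standard Gaussian vector in the direction of a unit vector. -/
theorem stdGaussian_prod_map_resample {e : E} (he : ‖e‖ = 1) :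
    ((stdGaussian E).prod (gaussianReal 0 1)).map
      (fun p => p.1 - ⟪e, p.1⟫ • e + p.2 • e) = stdGaussian E := by
  have hmeas : Measurable (fun p : E × ℝ => p.1 - ⟪e, p.1⟫ • e + p.2 • e) := by fun_prop
  have : IsProbabilityMeasure (((stdGaussian E).prod (gaussianReal 0 1)).map
      (fun p => p.1 - ⟪e, p.1⟫ • e + p.2 • e)) := Measure.isProbabilityMeasure_map hmeas.aemeasurable
  refine Measure.ext_of_charFun (funext fun t => ?_)
  rw [charFun_apply, integral_map hmeas.aemeasurable (by fun_prop)]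
  -- Paired with t, the first variable meets only the part of t orthogonal to e, the second only ⟪e,
  -- t⟫. The characteristic function thus factors, and Pythagoras recombines the exponents.
  have hsplit (p : E × ℝ) :
      Complex.exp (⟪p.1 - ⟪e, p.1⟫ • e + p.2 • e, t⟫ * Complex.I) =
        Complex.exp (⟪p.1, t - ⟪e, t⟫ • e⟫ * Complex.I) *
          Complex.exp (⟪e, t⟫ * p.2 * Complex.I) := by
    rw [← Complex.exp_add, ← add_mul]
    congr 2
    norm_cast
    simp only [inner_add_left, inner_sub_left, inner_sub_right, real_inner_smul_left,
      real_inner_smul_right, real_inner_comm e p.1]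
    ring
  simp_rw [hsplit]
  rw [integral_prod_mul (fun x : E => Complex.exp (⟪x, t - ⟪e, t⟫ • e⟫ * Complex.I))
    (fun s : ℝ => Complex.exp (⟪e, t⟫ * s * Complex.I)), ← charFun_apply, ← charFun_apply_real,
    charFun_stdGaussian, charFun_stdGaussian, charFun_gaussianReal, ← Complex.exp_add]
  congr 1
  have hn : ‖t - ⟪e, t⟫ • e‖ ^ 2 = ‖t‖ ^ 2 - ⟪e, t⟫ ^ 2 := by
    rw [norm_sub_sq_real, real_inner_smul_right, norm_smul, he, real_inner_comm]
    simp only [Real.norm_eq_abs, mul_one, sq_abs]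
    ring
  rw [← Complex.ofReal_pow, hn]
  push_cast
  ring

/-- A shift along e moves only the resampled coordinate, so on each line parallel to e it turns
N(0,1) into N(r,1). -/
theorem stdGaussian_real_shift_eq_integral {e : E} (he : ‖e‖ = 1) (r : ℝ) {B : Set E}
    (hB : MeasurableSet B) :
    (stdGaussian E).real {z | z + r • e ∈ B} =
      ∫ x, (gaussianReal r 1).real {s | x - ⟪e, x⟫ • e + s • e ∈ B} ∂(stdGaussian E) := by
  have hmeas : Measurable (fun p : E × ℝ => p.1 - ⟪e, p.1⟫ • e + p.2 • e) := by fun_prop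
  have hS : MeasurableSet {z : E | z + r • e ∈ B} := by
    have : Measurable fun z : E => z + r • e := by fun_prop
    exact this hB
  conv_lhs => rw [← stdGaussian_prod_map_resample he]
  rw [map_measureReal_apply hmeas hS, measureReal_prod_eq_integral _ _ (hmeas hS)]
  refine integral_congr_ae (ae_of_all _ fun x => ?_)
  have h : gaussianReal r 1 = (gaussianReal 0 1).map (fun y => y + r) := by
    rw [gaussianReal_map_add_const, zero_add]
  have hT : MeasurableSet {s : ℝ | x - ⟪e, x⟫ • e + s • e ∈ B} := by
    have : Measurable fun s : ℝ => x - ⟪e, x⟫ • e + s • e := by fun_prop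
    exact this hB
  simp only
  rw [h, map_measureReal_apply (by fun_prop) hT]
  congr 1
  ext s
  simp [add_smul, add_assoc]

theorem integrable_gaussianReal_slice (e : E) (r : ℝ) {B : Set E} (hB : MeasurableSet B) :
    Integrable (fun x => (gaussianReal r 1).real {s | x - ⟪e, x⟫ • e + s • e ∈ B})
      (stdGaussian E) := by
  have hmeas : Measurable (fun p : E × ℝ => p.1 - ⟪e, p.1⟫ • e + p.2 • e) := by fun_prop
  exact Measure.integrable_measure_prodMk_left (hmeas hB) (measure_ne_top _ _)

/-- With e = v/‖v‖, both masses are averages over the same lines, and the one-dimensional bound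
integrates. More than γ > 0 is needed only for v = 0. -/
theorem stdGaussian_real_shift_sub_le {γ : ℝ} (hγ : 1 ≤ γ) (v : E) {B : Set E}
    (hB : MeasurableSet B) :
    (stdGaussian E).real {z | z + v ∈ B} - γ * (stdGaussian E).real B ≤ theta γ ‖v‖ₑ := by
  by_cases hv : v = 0
  · subst hv
    have : 0 ≤ (stdGaussian E).real B := measureReal_nonneg
    simp only [add_zero, Set.ofPred_mem_eq, enorm_zero, theta, if_true]
    nlinarith
  have hr : 0 < ‖v‖ := norm_pos_iff.2 hv
  set e : E := ‖v‖⁻¹ • v with he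
  have hen : ‖e‖ = 1 := by rw [he, norm_smul, norm_inv, norm_norm, inv_mul_cancel₀ hr.ne']
  have hve : v = ‖v‖ • e := by rw [he, smul_inv_smul₀ hr.ne']
  have h1 := stdGaussian_real_shift_eq_integral hen ‖v‖ hB
  have h0 := stdGaussian_real_shift_eq_integral hen 0 hB
  rw [← hve] at h1
  simp only [zero_smul, add_zero, Set.ofPred_mem_eq] at h0
  rw [h1, h0, ← integral_const_mul, ← integral_sub (integrable_gaussianReal_slice e _ hB)
    ((integrable_gaussianReal_slice e _ hB).const_mul γ), ← ofReal_norm, theta_ofReal hr]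
  refine (integral_mono ((integrable_gaussianReal_slice e _ hB).sub
    ((integrable_gaussianReal_slice e _ hB).const_mul γ)) (integrable_const _)
    fun x => gaussianReal_real_sub_le (by linarith) hr ?_).trans_eq (by simp)
  have : Measurable fun s : ℝ => x - ⟪e, x⟫ • e + s • e := by fun_prop
  exact this hB

theorem stdGaussian_real_affine_sub_le {γ σ : ℝ} (hγ : 1 ≤ γ) (hσ : 0 < σ) {m m' : E} {D : ℝ≥0∞}
    (hD : ‖m - m'‖ₑ ≤ D) {B : Set E} (hB : MeasurableSet B) :
    (stdGaussian E).real {z | m + σ • z ∈ B} - γ * (stdGaussian E).real {z | m' + σ • z ∈ B} ≤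
      theta γ (D / ENNReal.ofReal σ) := by
  have hB' : MeasurableSet {z : E | m' + σ • z ∈ B} := by
    have : Measurable fun z : E => m' + σ • z := by fun_prop
    exact this hB
  have h := stdGaussian_real_shift_sub_le hγ (σ⁻¹ • (m - m')) hB'
  have hs : {z : E | z + σ⁻¹ • (m - m') ∈ {z : E | m' + σ • z ∈ B}} = {z | m + σ • z ∈ B} := by
    ext z
    simp only [Set.mem_ofPred_eq, smul_add, smul_inv_smul₀ hσ.ne']
    rw [show m' + (σ • z + (m - m')) = m + σ • z by abel]
  rw [hs] at h
  refine h.trans (theta_mono (by linarith) ?_)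
  rw [enorm_smul, Real.enorm_eq_ofReal (inv_nonneg.2 hσ.le), ENNReal.ofReal_inv_of_pos hσ,
    mul_comm, ← div_eq_mul_inv]
  gcongr

end GaussianSpace

/-! ### Contraction of the hockey-stick divergence. -/

section HockeyStick

variable {S : Type*} [MeasurableSpace S]

/-- The `E_γ`-divergence of `μ` from `ν` is at most `δ`. -/
def HockeyStickLE (γ δ : ℝ) (μ ν : Measure S) : Prop :=
  ∀ A : Set S, MeasurableSet A → μ.real A - γ * ν.real A ≤ δ

/-- On a Hahn set s of μ − γν, raising g to 1 increases the left side; off s, lowering it to 0 does.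
The indicator of s is therefore the worst case. -/
theorem HockeyStickLE.integral_sub_le {γ δ : ℝ} {μ ν : Measure S} [IsFiniteMeasure μ]
    [IsFiniteMeasure ν] (hγ : 0 ≤ γ) (h : HockeyStickLE γ δ μ ν) {g : S → ℝ} (hg : Measurable g)
    (hg0 : ∀ x, 0 ≤ g x) (hg1 : ∀ x, g x ≤ 1) :
    ∫ x, g x ∂μ - γ * ∫ x, g x ∂ν ≤ δ := by
  lift γ to NNReal using hγ
  have hint (ρ : Measure S) [IsFiniteMeasure ρ] : Integrable g ρ :=
    Integrable.of_bound hg.aestronglyMeasurable 1 (ae_of_all _ fun x => by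
      rw [Real.norm_eq_abs, abs_of_nonneg (hg0 x)]; exact hg1 x)
  have hint' (ρ : Measure S) [IsFiniteMeasure ρ] : Integrable (fun x => 1 - g x) ρ :=
    (integrable_const 1).sub (hint ρ)
  obtain ⟨s, hs, hpos, hneg⟩ := hahn_decomposition μ (γ • ν)
  have hle : (γ • ν).restrict s ≤ μ.restrict s :=
    Measure.le_iff.2 fun t ht => by
      rw [Measure.restrict_apply ht, Measure.restrict_apply ht]
      exact hpos _ (ht.inter hs) Set.inter_subset_right
  have hle' : μ.restrict sᶜ ≤ (γ • ν).restrict sᶜ :=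
    Measure.le_iff.2 fun t ht => by
      rw [Measure.restrict_apply ht, Measure.restrict_apply ht]
      exact hneg _ (ht.inter hs.compl) Set.inter_subset_right
  have h1 : ∫ x in sᶜ, g x ∂μ ≤ ∫ x in sᶜ, g x ∂(γ • ν) :=
    integral_mono_measure hle' (ae_of_all _ hg0) (hint _)
  have h2 : ∫ x in s, (1 - g x) ∂(γ • ν) ≤ ∫ x in s, (1 - g x) ∂μ :=
    integral_mono_measure hle (ae_of_all _ fun x => sub_nonneg.2 (hg1 x)) (hint' _)
  rw [integral_sub (integrable_const 1) (hint _), integral_sub (integrable_const 1) (hint _),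
    integral_const, integral_const] at h2
  simp only [measureReal_restrict_apply_univ, smul_eq_mul, mul_one] at h2
  have h3 := h s hs
  have h4 : (γ • ν).real s = γ * ν.real s := by
    rw [measureReal_def, Measure.smul_apply, ENNReal.smul_def, smul_eq_mul, ENNReal.toReal_mul]
    rfl
  have h5 : ∫ x, g x ∂(γ • ν) = γ * ∫ x, g x ∂ν := by
    rw [integral_smul_nnreal_measure]; rfl
  rw [← h5, ← integral_add_compl hs (hint μ), ← integral_add_compl hs (hint (γ • ν))]
  rw [h4] at h2
  linarith

/-- Contraction of the `E_γ`-divergence, in dual form: integrating a function whose values satisfy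
`g x - γ * g y ≤ η` multiplies the divergence by at most `η`. -/
theorem HockeyStickLE.integral_sub_le_mul {γ δ η : ℝ} {μ ν : Measure S} [IsProbabilityMeasure μ]
    [IsProbabilityMeasure ν] (hγ : 1 ≤ γ) (hδ0 : 0 ≤ δ) (hδ1 : δ ≤ 1)
    (h : HockeyStickLE γ δ μ ν) {g : S → ℝ} (hg : Measurable g)
    (hg0 : ∀ x, 0 ≤ g x) (hg1 : ∀ x, g x ≤ 1) (hη0 : 0 ≤ η) (hη : ∀ x y, g x - γ * g y ≤ η) :
    ∫ x, g x ∂μ - γ * ∫ x, g x ∂ν ≤ δ * η := by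
  have hS : Nonempty S := nonempty_of_isProbabilityMeasure μ
  have hbb : BddBelow (Set.range g) := ⟨0, by rintro _ ⟨x, rfl⟩; exact hg0 x⟩
  have hba : BddAbove (Set.range g) := ⟨1, by rintro _ ⟨x, rfl⟩; exact hg1 x⟩
  set a := ⨅ x, g x
  set b := ⨆ x, g x
  have ha (x : S) : a ≤ g x := ciInf_le hbb x
  have hb (x : S) : g x ≤ b := le_ciSup hba x
  have ha0 : 0 ≤ a := le_ciInf hg0
  have hint (ρ : Measure S) [IsFiniteMeasure ρ] : Integrable g ρ :=
    Integrable.of_bound hg.aestronglyMeasurable 1 (ae_of_all _ fun x => by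
      rw [Real.norm_eq_abs, abs_of_nonneg (hg0 x)]; exact hg1 x)
  have hab : b - γ * a ≤ η := by
    have h1 (y : S) : b ≤ η + γ * g y := ciSup_le fun x => by linarith [hη x y]
    have h2 : (b - η) / γ ≤ a := le_ciInf fun y => by
      rw [div_le_iff₀ (by linarith)]; linarith [h1 y]
    rw [div_le_iff₀ (by linarith)] at h2
    linarith
  have hle : a ≤ b := (ha hS.some).trans (hb hS.some)
  -- Testing with (g − a)/(b − a) bounds the left side by δ(b − a) − a(γ − 1), which equals δ(b −
  -- γa) minus this cross term. Here γ ≥ 1 and δ ≤ 1 are essential.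
  have hcross : 0 ≤ a * (γ - 1) * (1 - δ) :=
    mul_nonneg (mul_nonneg ha0 (by linarith)) (by linarith)
  have hδη : δ * (b - γ * a) ≤ δ * η := mul_le_mul_of_nonneg_left hab hδ0
  rcases hle.eq_or_lt with heq | hlt
  · have hconst : g = fun _ => a := funext fun x => le_antisymm (heq ▸ hb x) (ha x)
    rw [hconst]
    simp only [integral_const, probReal_univ, one_smul]
    have := mul_nonneg hδ0 hη0
    nlinarith
  · have hba' : 0 < b - a := sub_pos.2 hlt
    have key := h.integral_sub_le (by linarith) (g := fun x => (g x - a) / (b - a))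
      ((hg.sub_const a).div_const _) (fun x => div_nonneg (sub_nonneg.2 (ha x)) hba'.le)
      (fun x => (div_le_one hba').2 (by linarith [hb x]))
    rw [integral_div, integral_div, integral_sub (hint _) (integrable_const _),
      integral_sub (hint _) (integrable_const _)] at key
    simp only [integral_const, probReal_univ, one_smul] at key
    rw [← mul_div_assoc, ← sub_div, div_le_iff₀ hba'] at key
    nlinarith

end HockeyStick

/-! ### The projection. -/

section Projection

variable {d : ℕ} {W : Set (EuclideanSpace ℝ (Fin d))}

open scoped RealInnerProductSpace

theorem inner_sub_projOnto_nonpos (hne : W.Nonempty) (hcl : IsClosed W) (hconv : Convex ℝ W)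
    (x : EuclideanSpace ℝ (Fin d)) {w : EuclideanSpace ℝ (Fin d)} (hw : w ∈ W) :
    ⟪x - projOnto hne hcl x, w - projOnto hne hcl x⟫ ≤ 0 := by
  refine (norm_eq_iInf_iff_real_inner_le_zero hconv (projOnto hne hcl x).2).1 ?_ w hw
  have h : Metric.infDist x W = dist x (projOnto hne hcl x) :=
    (hcl.exists_infDist_eq_dist hne x).choose_spec.2
  rw [Metric.infDist_eq_iInf] at h
  simp_rw [dist_eq_norm] at h
  exact h.symm

/-- Add the two variational inequalities and apply Cauchy–Schwarz. Nonexpansiveness serves only to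
make the projection measurable. -/
theorem lipschitzWith_projOnto (hne : W.Nonempty) (hcl : IsClosed W) (hconv : Convex ℝ W) :
    LipschitzWith 1 (projOnto hne hcl) := by
  refine LipschitzWith.mk_one fun x y => ?_
  have hx := inner_sub_projOnto_nonpos hne hcl hconv x (projOnto hne hcl y).2
  have hy := inner_sub_projOnto_nonpos hne hcl hconv y (projOnto hne hcl x).2
  rw [Subtype.dist_eq, dist_eq_norm, dist_eq_norm]
  set p : EuclideanSpace ℝ (Fin d) := ↑(projOnto hne hcl x)
  set q : EuclideanSpace ℝ (Fin d) := ↑(projOnto hne hcl y)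
  have h : ‖p - q‖ * ‖p - q‖ ≤ ‖x - y‖ * ‖p - q‖ := by
    refine le_trans ?_ (real_inner_le_norm (x - y) (p - q))
    rw [← real_inner_self_eq_norm_mul_norm]
    simp only [inner_sub_left, inner_sub_right] at hx hy ⊢
    linarith
  rcases (norm_nonneg (p - q)).eq_or_lt with h0 | h0
  · rw [← h0]; exact norm_nonneg _
  · exact le_of_mul_le_mul_right h h0

theorem measurable_projOnto (hne : W.Nonempty) (hcl : IsClosed W) (hconv : Convex ℝ W) :
    Measurable (projOnto hne hcl) :=
  (lipschitzWith_projOnto hne hcl hconv).continuous.measurable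

/-! ### The noisy iteration as a Markov chain. -/

theorem measurable_noisyStep (hne : W.Nonempty) (hcl : IsClosed W) (hconv : Convex ℝ W)
    {φ : W → EuclideanSpace ℝ (Fin d)} (hφ : Measurable φ) (s : ℝ) :
    Measurable fun p : W × EuclideanSpace ℝ (Fin d) => projOnto hne hcl (φ p.1 + s • p.2) :=
  (measurable_projOnto hne hcl hconv).comp (by fun_prop)

theorem measurable_noisyIterate (hne : W.Nonempty) (hcl : IsClosed W) (hconv : Convex ℝ W)
    {n : ℕ} {Φ : Fin n → W → EuclideanSpace ℝ (Fin d)} (hΦ : ∀ t, Measurable (Φ t))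
    (σ : Fin n → ℝ) :
    Measurable fun p : W × (Fin n → EuclideanSpace ℝ (Fin d)) =>
      noisyIterate hne hcl n Φ σ p.1 p.2 := by
  induction n with
  | zero => exact measurable_fst
  | succ n ih =>
    have hinit : Measurable fun p : W × (Fin (n + 1) → EuclideanSpace ℝ (Fin d)) =>
        (p.1, fun t : Fin n => p.2 t.castSucc) := by fun_prop
    have h := (ih (fun t => hΦ t.castSucc) (fun t => σ t.castSucc)).comp hinit
    have hlast : Measurable fun p : W × (Fin (n + 1) → EuclideanSpace ℝ (Fin d)) =>
        p.2 (Fin.last n) := by fun_prop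
    have hstep := measurable_noisyStep hne hcl hconv (hΦ (Fin.last n)) (σ (Fin.last n))
    have hcomp := hstep.comp (h.prodMk hlast)
    simpa only [Function.comp_def, noisyIterate] using hcomp

/-- The law of `Π_W (φ w + s z)` for `w` with law `μ` and independent standard Gaussian `z`. -/
noncomputable def noisyStepLaw (hne : W.Nonempty) (hcl : IsClosed W) (φ : W → EuclideanSpace ℝ (Fin d)) (s : ℝ)
    (μ : Measure W) : Measure W :=
  (μ.prod (stdGaussian (EuclideanSpace ℝ (Fin d)))).map
    fun p => projOnto hne hcl (φ p.1 + s • p.2)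

/-- The law of the noisy iteration with independent standard Gaussian noise started from `μ`. -/
noncomputable def noisyIterateLaw (hne : W.Nonempty) (hcl : IsClosed W) (n : ℕ)
    (Φ : Fin n → W → EuclideanSpace ℝ (Fin d)) (σ : Fin n → ℝ) (μ : Measure W) : Measure W :=
  (μ.prod (Measure.pi fun _ : Fin n => stdGaussian (EuclideanSpace ℝ (Fin d)))).map
    fun p => noisyIterate hne hcl n Φ σ p.1 p.2

/-- The Markov property: the last noise vector is independent of the start and of all earlier noise.
-/
theorem noisyIterateLaw_succ (hne : W.Nonempty) (hcl : IsClosed W) (hconv : Convex ℝ W) {n : ℕ}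
    {Φ : Fin (n + 1) → W → EuclideanSpace ℝ (Fin d)} (hΦ : ∀ t, Measurable (Φ t))
    (σ : Fin (n + 1) → ℝ) (μ : Measure W) [IsProbabilityMeasure μ] :
    noisyIterateLaw hne hcl (n + 1) Φ σ μ =
      noisyStepLaw hne hcl (Φ (Fin.last n)) (σ (Fin.last n))
        (noisyIterateLaw hne hcl n (fun t => Φ t.castSucc) (fun t => σ t.castSucc) μ) := by
  set G := stdGaussian (EuclideanSpace ℝ (Fin d))
  have hm := measurable_noisyIterate hne hcl hconv (fun t => hΦ (Fin.castSucc t))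
    (fun t => σ t.castSucc)
  have hstep := measurable_noisyStep hne hcl hconv (hΦ (Fin.last n)) (σ (Fin.last n))
  have hsplit : MeasurePreserving
      (fun z : Fin (n + 1) → EuclideanSpace ℝ (Fin d) =>
        ((fun t : Fin n => z t.castSucc), z (Fin.last n)))
      (Measure.pi fun _ => G) ((Measure.pi fun _ => G).prod G) := by
    -- `piFinSuccAbove` puts the extracted coordinate first, hence the swap.
    have h := Measure.measurePreserving_swap.comp
      (measurePreserving_piFinSuccAbove (fun _ : Fin (n + 1) => G) (Fin.last n))
    convert h using 1
    ext z t
    · simp [MeasurableEquiv.piFinSuccAbove, Fin.init]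
    · simp [MeasurableEquiv.piFinSuccAbove]
  have hassoc : MeasurePreserving
      (fun p : W × (Fin (n + 1) → EuclideanSpace ℝ (Fin d)) =>
        ((p.1, fun t : Fin n => p.2 t.castSucc), p.2 (Fin.last n)))
      (μ.prod (Measure.pi fun _ => G)) ((μ.prod (Measure.pi fun _ => G)).prod G) :=
    (measurePreserving_prodAssoc μ (Measure.pi fun _ : Fin n => G) G).symm.comp
      ((MeasurePreserving.id μ).prod hsplit)
  rw [noisyStepLaw, noisyIterateLaw, noisyIterateLaw]
  have hG : ((μ.prod (Measure.pi fun _ : Fin n => G)).map fun p =>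
      noisyIterate hne hcl n (fun t => Φ t.castSucc) (fun t => σ t.castSucc) p.1 p.2).prod G =
      ((μ.prod (Measure.pi fun _ : Fin n => G)).prod G).map (Prod.map (fun p =>
        noisyIterate hne hcl n (fun t => Φ t.castSucc) (fun t => σ t.castSucc) p.1 p.2) id) := by
    rw [← Measure.map_prod_map _ _ hm measurable_id, Measure.map_id]
  rw [hG, ← hassoc.map_eq, Measure.map_map (hm.prodMap measurable_id) hassoc.measurable,
    Measure.map_map hstep ((hm.prodMap measurable_id).comp hassoc.measurable)]
  rfl

theorem isProbabilityMeasure_noisyIterateLaw (hne : W.Nonempty) (hcl : IsClosed W)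
    (hconv : Convex ℝ W) {n : ℕ} {Φ : Fin n → W → EuclideanSpace ℝ (Fin d)}
    (hΦ : ∀ t, Measurable (Φ t)) (σ : Fin n → ℝ) (μ : Measure W) [IsProbabilityMeasure μ] :
    IsProbabilityMeasure (noisyIterateLaw hne hcl n Φ σ μ) :=
  Measure.isProbabilityMeasure_map (measurable_noisyIterate hne hcl hconv hΦ σ).aemeasurable

theorem noisyStepLaw_real (hne : W.Nonempty) (hcl : IsClosed W) (hconv : Convex ℝ W)
    {φ : W → EuclideanSpace ℝ (Fin d)} (hφ : Measurable φ) (s : ℝ) (μ : Measure W)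
    [IsFiniteMeasure μ] {A : Set W} (hA : MeasurableSet A) :
    (noisyStepLaw hne hcl φ s μ).real A = ∫ w, (stdGaussian (EuclideanSpace ℝ (Fin d))).real
      {z | φ w + s • z ∈ projOnto hne hcl ⁻¹' A} ∂μ := by
  have hstep := measurable_noisyStep hne hcl hconv hφ s
  rw [noisyStepLaw, map_measureReal_apply hstep hA, measureReal_prod_eq_integral _ _ (hstep hA)]
  rfl

theorem measurable_noisyStep_real (hne : W.Nonempty) (hcl : IsClosed W) (hconv : Convex ℝ W)
    {φ : W → EuclideanSpace ℝ (Fin d)} (hφ : Measurable φ) (s : ℝ) {A : Set W}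
    (hA : MeasurableSet A) :
    Measurable fun w => (stdGaussian (EuclideanSpace ℝ (Fin d))).real
      {z | φ w + s • z ∈ projOnto hne hcl ⁻¹' A} :=
  (measurable_measure_prodMk_left (measurable_noisyStep hne hcl hconv hφ s hA)).ennreal_toReal

/-! ### Divergence along the iteration. -/

theorem hockeyStickLE_noisyStepLaw_of_forall (hne : W.Nonempty) (hcl : IsClosed W)
    (hconv : Convex ℝ W) {φ φ' : W → EuclideanSpace ℝ (Fin d)} (hφ : Measurable φ)
    (hφ' : Measurable φ') {s γ η : ℝ} (μ : Measure W) [IsProbabilityMeasure μ]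
    (h : ∀ w, ∀ B : Set (EuclideanSpace ℝ (Fin d)), MeasurableSet B →
      (stdGaussian _).real {z | φ w + s • z ∈ B}
        - γ * (stdGaussian _).real {z | φ' w + s • z ∈ B} ≤ η) :
    HockeyStickLE γ η (noisyStepLaw hne hcl φ s μ) (noisyStepLaw hne hcl φ' s μ) := by
  intro A hA
  have hint {χ : W → EuclideanSpace ℝ (Fin d)} (hχ : Measurable χ) :
      Integrable (fun w => (stdGaussian (EuclideanSpace ℝ (Fin d))).real
        {z | χ w + s • z ∈ projOnto hne hcl ⁻¹' A}) μ :=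
    Integrable.of_bound
      (measurable_noisyStep_real hne hcl hconv hχ s hA).aestronglyMeasurable 1
      (ae_of_all _ fun w => by
        rw [Real.norm_eq_abs, abs_of_nonneg measureReal_nonneg]; exact measureReal_le_one)
  rw [noisyStepLaw_real hne hcl hconv hφ s μ hA, noisyStepLaw_real hne hcl hconv hφ' s μ hA,
    ← integral_const_mul, ← integral_sub (hint hφ) ((hint hφ').const_mul γ)]
  exact (integral_mono ((hint hφ).sub ((hint hφ').const_mul γ)) (integrable_const _)
    fun w => h w _ (measurable_projOnto hne hcl hconv hA)).trans_eq (by simp)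

/-- The contraction lemma applies to g(w), the probability of landing in A from w; `hη` bounds the
divergence between rows of the kernel. -/
theorem HockeyStickLE.noisyStepLaw (hne : W.Nonempty) (hcl : IsClosed W)
    (hconv : Convex ℝ W) {φ : W → EuclideanSpace ℝ (Fin d)} (hφ : Measurable φ)
    {s γ δ η : ℝ} (hγ : 1 ≤ γ) (hδ0 : 0 ≤ δ) (hδ1 : δ ≤ 1) (hη0 : 0 ≤ η)
    {μ ν : Measure W} [IsProbabilityMeasure μ] [IsProbabilityMeasure ν]
    (h : HockeyStickLE γ δ μ ν)
    (hη : ∀ w w', ∀ B : Set (EuclideanSpace ℝ (Fin d)), MeasurableSet B →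
      (stdGaussian _).real {z | φ w + s • z ∈ B}
        - γ * (stdGaussian _).real {z | φ w' + s • z ∈ B} ≤ η) :
    HockeyStickLE γ (δ * η) (noisyStepLaw hne hcl φ s μ) (noisyStepLaw hne hcl φ s ν) := by
  intro A hA
  rw [noisyStepLaw_real hne hcl hconv hφ s μ hA, noisyStepLaw_real hne hcl hconv hφ s ν hA]
  exact h.integral_sub_le_mul hγ hδ0 hδ1 (measurable_noisyStep_real hne hcl hconv hφ s hA)
    (fun _ => measureReal_nonneg) (fun _ => measureReal_le_one) hη0
    fun w w' => hη w w' _ (measurable_projOnto hne hcl hconv hA)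

theorem prod_Ioi_castSucc {n : ℕ} (f : Fin (n + 1) → ℝ) (i : Fin n) :
    ∏ t ∈ Finset.Ioi i.castSucc, f t = (∏ t ∈ Finset.Ioi i, f t.castSucc) * f (Fin.last n) := by
  have h : Finset.Ioi i.castSucc = Finset.cons (Fin.last n)
      ((Finset.Ioi i).map Fin.castSuccEmb) (by simp) := by
    ext t
    cases t using Fin.lastCases with
    | last => simp [Fin.castSucc_lt_last]
    | cast t => simpa using fun _ => Fin.le_last _
  rw [h, Finset.prod_cons, Finset.prod_map, mul_comm]
  rfl

/-- Peel off the last step. If it is step i, the laws before it coincide and the rules are compared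
pointwise; otherwise both processes use the same kernel, which contracts the inductive bound. -/
theorem hockeyStickLE_noisyIterateLaw (hne : W.Nonempty) (hcl : IsClosed W) (hconv : Convex ℝ W)
    {γ : ℝ} (hγ : 1 ≤ γ) (μ : Measure W) [IsProbabilityMeasure μ] {n : ℕ}
    {Φ Φ' : Fin n → W → EuclideanSpace ℝ (Fin d)} (hΦ : ∀ t, Measurable (Φ t))
    (hΦ' : ∀ t, Measurable (Φ' t)) {σ : Fin n → ℝ} {i : Fin n} (heq : ∀ t, t ≠ i → Φ t = Φ' t)
    {η : Fin n → ℝ} (hη0 : ∀ t, 0 ≤ η t) (hη1 : ∀ t, η t ≤ 1)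
    (hi : ∀ w, ∀ B : Set (EuclideanSpace ℝ (Fin d)), MeasurableSet B →
      (stdGaussian _).real {z | Φ i w + σ i • z ∈ B}
        - γ * (stdGaussian _).real {z | Φ' i w + σ i • z ∈ B} ≤ η i)
    (hlt : ∀ t, i < t → ∀ w w', ∀ B : Set (EuclideanSpace ℝ (Fin d)), MeasurableSet B →
      (stdGaussian _).real {z | Φ t w + σ t • z ∈ B}
        - γ * (stdGaussian _).real {z | Φ t w' + σ t • z ∈ B} ≤ η t) :
    HockeyStickLE γ (η i * ∏ t ∈ Finset.Ioi i, η t)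
      (noisyIterateLaw hne hcl n Φ σ μ) (noisyIterateLaw hne hcl n Φ' σ μ) := by
  induction n with
  | zero => exact i.elim0
  | succ n ih =>
    rw [noisyIterateLaw_succ hne hcl hconv hΦ, noisyIterateLaw_succ hne hcl hconv hΦ']
    have hp := isProbabilityMeasure_noisyIterateLaw hne hcl hconv (fun t => hΦ (Fin.castSucc t))
      (fun t => σ t.castSucc) μ
    have hp' := isProbabilityMeasure_noisyIterateLaw hne hcl hconv
      (fun t => hΦ' (Fin.castSucc t)) (fun t => σ t.castSucc) μ
    cases i using Fin.lastCases with
    | last =>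
      have hinit : (fun t : Fin n => Φ t.castSucc) = fun t => Φ' t.castSucc :=
        funext fun t => heq _ (Fin.castSucc_ne_last t)
      have hIoi : Finset.Ioi (Fin.last n) = ∅ := by
        ext t; simpa using Fin.le_last t
      rw [hinit, hIoi, Finset.prod_empty, mul_one]
      exact hockeyStickLE_noisyStepLaw_of_forall hne hcl hconv (hΦ _) (hΦ' _) _ hi
    | cast j =>
      rw [← heq _ (Fin.castSucc_ne_last j).symm, prod_Ioi_castSucc, ← mul_assoc]
      refine HockeyStickLE.noisyStepLaw hne hcl hconv (hΦ _) hγ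
        (mul_nonneg (hη0 _) (Finset.prod_nonneg fun t _ => hη0 _))
        (mul_le_one₀ (hη1 _) (Finset.prod_nonneg fun t _ => hη0 _)
          (Finset.prod_le_one (fun t _ => hη0 _) fun t _ => hη1 _)) (hη0 _) ?_
        (hlt _ (Fin.castSucc_lt_last j))
      exact ih (i := j) (η := fun t => η t.castSucc) (fun t => hΦ _) (fun t => hΦ' _)
        (fun t ht => heq _ fun h => ht (Fin.castSucc_injective n h))
        (fun t => hη0 _) (fun t => hη1 _) hi fun t ht => hlt _ (Fin.castSucc_lt_castSucc_iff.2 ht)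

/-! ### From laws back to the random process. -/

theorem map_onlineAlgorithm {n : ℕ} (hne : W.Nonempty) (hcl : IsClosed W) (hconv : Convex ℝ W)
    {F : Set (W → ℝ)} {Ψ : Fin n → F → W → EuclideanSpace ℝ (Fin d)}
    (hΨ : ∀ t f, Measurable (Ψ t f)) (σ : Fin n → ℝ)
    {Ω : Type*} [MeasurableSpace Ω] (P : Measure Ω) [IsProbabilityMeasure P]
    {W₁ : Ω → W} (hW₁ : AEMeasurable W₁ P) {Z : Fin n → Ω → EuclideanSpace ℝ (Fin d)}
    (hZlaw : ∀ t, HasLaw (Z t) (stdGaussian (EuclideanSpace ℝ (Fin d))) P)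
    (hZindep : iIndepFun Z P) (hWZ : IndepFun W₁ (fun ω t => Z t ω) P)
    (f : Fin n → F) {A : Set W} (hA : MeasurableSet A) :
    P.real (onlineAlgorithm hne hcl Ψ σ W₁ Z f ⁻¹' A) =
      (noisyIterateLaw hne hcl n (fun t => Ψ t (f t)) σ (P.map W₁)).real A := by
  have hm := measurable_noisyIterate hne hcl hconv (fun t => hΨ t (f t)) σ
  have hZm : AEMeasurable (fun ω t => Z t ω) P :=
    aemeasurable_pi_lambda _ fun t => (hZlaw t).aemeasurable
  have hZ : P.map (fun ω t => Z t ω) =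
      Measure.pi fun _ => stdGaussian (EuclideanSpace ℝ (Fin d)) := by
    rw [(iIndepFun_iff_map_fun_eq_pi_map fun t => (hZlaw t).aemeasurable).1 hZindep]
    simp_rw [fun t => (hZlaw t).map_eq]
  have hjoint := (indepFun_iff_map_prod_eq_prod_map_map hW₁ hZm).1 hWZ
  rw [noisyIterateLaw, ← hZ, ← hjoint, AEMeasurable.map_map_of_aemeasurable hm.aemeasurable
    (hW₁.prodMk hZm), measureReal_def, measureReal_def,
    Measure.map_apply_of_aemeasurable (hm.comp_aemeasurable (hW₁.prodMk hZm)) hA]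
  rfl

theorem privacyDelta_le_one {n : ℕ} {F : Set (W → ℝ)}
    (Ψ : Fin n → F → W → EuclideanSpace ℝ (Fin d)) (σ : Fin n → ℝ) (ε : ℝ) (i : Fin n)
    (f : Fin n → F) : privacyDelta Ψ σ ε i f ≤ 1 :=
  mul_le_one₀ (theta_le_one (Real.exp_pos ε) _)
    (Finset.prod_nonneg fun _ _ => theta_nonneg (Real.exp_pos ε) _)
    (Finset.prod_le_one (fun _ _ => theta_nonneg (Real.exp_pos ε) _)
      fun _ _ => theta_le_one (Real.exp_pos ε) _)

end Projection

theorem theorem4 {d n : ℕ} {W : Set (EuclideanSpace ℝ (Fin d))}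
    (hne : W.Nonempty) (hcl : IsClosed W) (hconv : Convex ℝ W)
    -- the cost functions, the update rules and the noise magnitudes
    (F : Set (W → ℝ)) (Ψ : Fin n → F → W → EuclideanSpace ℝ (Fin d))
    (hΨ : ∀ t f, Measurable (Ψ t f))
    (σ : Fin n → ℝ) (hσ : ∀ t, 0 < σ t)
    -- the random initial point and the i.i.d. standard Gaussian noise
    {Ω : Type*} [MeasurableSpace Ω] (P : Measure Ω) [IsProbabilityMeasure P]
    (W₁ : Ω → W) (hW₁ : AEMeasurable W₁ P)
    (Z : Fin n → Ω → EuclideanSpace ℝ (Fin d))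
    (hZlaw : ∀ t, HasLaw (Z t) (stdGaussian (EuclideanSpace ℝ (Fin d))) P)
    (hZindep : iIndepFun Z P) (hWZ : IndepFun W₁ (fun ω t => Z t ω) P)
    (i : Fin n) (ε : ℝ) (hε : 0 ≤ ε) :
    (∀ f f' : Fin n → F, Neighboring i f f' → ∀ A : Set W, MeasurableSet A →
      P.real (onlineAlgorithm hne hcl Ψ σ W₁ Z f ⁻¹' A)
        - Real.exp ε * P.real (onlineAlgorithm hne hcl Ψ σ W₁ Z f' ⁻¹' A)
          ≤ privacyDelta Ψ σ ε i f) ∧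
    IsDPAtIndex P (onlineAlgorithm hne hcl Ψ σ W₁ Z) i ε
      (⨆ f : Fin n → F, privacyDelta Ψ σ ε i f) := by
  have hγ : 1 ≤ Real.exp ε := Real.one_le_exp hε
  have main : ∀ f f' : Fin n → F, Neighboring i f f' → ∀ A : Set W, MeasurableSet A →
      P.real (onlineAlgorithm hne hcl Ψ σ W₁ Z f ⁻¹' A)
        - Real.exp ε * P.real (onlineAlgorithm hne hcl Ψ σ W₁ Z f' ⁻¹' A)
          ≤ privacyDelta Ψ σ ε i f := by
    intro f f' hff' A hA
    have hP : IsProbabilityMeasure (P.map W₁) := Measure.isProbabilityMeasure_map hW₁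
    rw [map_onlineAlgorithm hne hcl hconv hΨ σ P hW₁ hZlaw hZindep hWZ f hA,
      map_onlineAlgorithm hne hcl hconv hΨ σ P hW₁ hZlaw hZindep hWZ f' hA]
    -- One family for both kinds of factor; its values at t < i never enter the product.
    set η : Fin n → ℝ := fun t =>
      if t = i then theta (Real.exp ε) (updateGap (Ψ i) / ENNReal.ofReal (σ i))
      else theta (Real.exp ε)
        (Metric.ediam (Set.range (Ψ t (f t))) / ENNReal.ofReal (σ t)) with hη
    have hδ : privacyDelta Ψ σ ε i f = η i * ∏ t ∈ Finset.Ioi i, η t := by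
      rw [privacyDelta]
      congr 1
      · simp [hη]
      · exact Finset.prod_congr rfl fun t ht => by
          simp only [hη]; rw [if_neg (Finset.mem_Ioi.1 ht).ne']
    rw [hδ]
    refine hockeyStickLE_noisyIterateLaw hne hcl hconv hγ (P.map W₁) (fun t => hΨ t (f t))
      (fun t => hΨ t (f' t)) (fun t ht => by rw [hff'.1 t ht]) (fun t => ?_) (fun t => ?_)
      (fun w B hB => ?_) (fun t ht w w' B hB => ?_) A hA
    · simp only [hη]; split_ifs <;> exact theta_nonneg (Real.exp_pos ε) _
    · simp only [hη]; split_ifs <;> exact theta_le_one (Real.exp_pos ε) _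
    · simp only [hη, if_true]
      refine stdGaussian_real_affine_sub_le hγ (hσ i) ?_ hB
      exact le_iSup_of_le (f i) (le_iSup_of_le (f' i)
        (le_iSup (fun w => ‖Ψ i (f i) w - Ψ i (f' i) w‖ₑ) w))
    · simp only [hη]
      rw [if_neg ht.ne']
      refine stdGaussian_real_affine_sub_le hγ (hσ t) ?_ hB
      rw [← edist_eq_enorm_sub]
      exact Metric.edist_le_ediam_of_mem (Set.mem_range_self w) (Set.mem_range_self w')
  refine ⟨main, fun f f' hff' A hA => (main f f' hff' A hA).trans ?_⟩
  -- An unbounded real supremum would default to 0, so the upper bound 1 is needed.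
  refine le_ciSup (f := fun f : Fin n → F => privacyDelta Ψ σ ε i f) ⟨1, ?_⟩ f
  rintro _ ⟨g, rfl⟩
  exact privacyDelta_le_one Ψ σ ε i g
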